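/- Let $\mathcal S^{n\times n}$ be the space of real symmetric $n\times n$ matrices with the Frobenius inner product, let $\mathcal O(n)\subset\mathbb R^{n\times n}$ be the set of orthogonal matrices, regarded as a Riemannian submanifold of $\mathbb R^{n\times n}$ with the Frobenius inner product, and let $F:\mathcal S^{n\times n}\to\mathbb R$ be differentiable with $$\|\nabla F(X_1)-\nabla F(X_2)\|_F\le L_F\|X_1-X_2\|_F\qquad\text{for all }X_1,X_2\in\mathcal S^{n\times n},$$ where $L_F>0$. Put $f(U,\lambda)=F(U\,\mathrm{Diag}(\lambda)\,U^\top)$ for $U\in\mathbb R^{n\times n}$, $\lambda\in\mathbb R^n$, and let $\mathcal C\subset\mathbb R^n$ satisfy $\|\lambda\|\le D$ for all $\lambda\in\mathcal C$. Let $\mathrm{Exp}$ be the Riemannian exponential map of $\mathcal O(n)$. A retraction on $\mathcal O(n)$ is a smooth map $R:T\mathcal O(n)\to\mathcal O(n)$ such that, for all $Q\in\mathcal O(n)$ and $V\in T_Q\mathcal O(n)$, the curve $t\mapsto R(Q,tV)$ starts at $Q$ with velocity $V$. 1. For every retraction $R$ on $\mathcal O(n)$ the restriction of $f$ to $\mathcal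 O(n)\times\mathcal C$ satisfies the following Lipschitz conditions, where $\nabla_\lambda f$ exists on $\mathcal O(n)\times\mathcal C$: (a) there is $L_\lambda\ge 0$ with $\|\nabla_\lambda f(Q,\lambda_1)-\nabla_\lambda f(Q,\lambda_2)\|\le L_\lambda\|\lambda_1-\lambda_2\|$ for all $Q\in\mathcal O(n)$, $\lambda_1,\lambda_2\in\mathcal C$; (b) there is $L_Q\ge 1$ such that for every $\lambda\in\mathcal C$ the function $f(\cdot,\lambda):\mathcal O(n)\to\mathbb R$ has a Riemannian gradient $\operatorname{grad} f(\cdot,\lambda)$ and, both for $\mathcal R=\mathrm{Exp}$ and for $\mathcal R=R$, $$f(\mathcal R(Q,V),\lambda)\le f(Q,\lambda)+\langle\operatorname{grad} f(Q,\lambda),V\rangle+\tfrac{L_Q}{2}\|V\|_F^2\qquad\text{for all }Q\in\mathcal O(n),\ V\in T_Q\mathcal O(n);$$ (c) there is $L_{Q\lambda}\ge 0$ with $\|\nabla_\lambda f(Q_1,\lambda)-\nabla_\lambda f(Q_2,\lambda)\|\le L_{Q\lambda}\|Q_1-Q_2\|_F$ for all $Q_1,Q_2\in\mathcal O(n)$,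 $\lambda\in\mathcal C$. 2. For every $Q\in\mathcal O(n)$ the function $f(Q,\cdot)$ is differentiable on $\mathbb R^n$, and $\|\nabla_\lambda f(Q,\lambda_1)-\nabla_\lambda f(Q,\lambda_2)\|\le\sqrt n\,L_F\|\lambda_1-\lambda_2\|$ for all $\lambda_1,\lambda_2\in\mathbb R^n$. 3. There is $L_G\ge 0$ such that for every $\lambda\in\mathcal C$ the function $G_\lambda=f(\cdot,\lambda)$ is differentiable on $\mathbb R^{n\times n}$ and $\|\nabla G_\lambda(U)-\nabla G_\lambda(V)\|_F\le L_G\|U-V\|_F$ for all $U,V$ in the convex hull of $\mathcal O(n)$. -/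

import Mathlib

open Set Filter Topology
open scoped ContDiff Gradient

attribute [local instance] Matrix.frobeniusNormedAddCommGroup Matrix.frobeniusNormedSpace

namespace SpectralLip

section Submanifold

/-! ### Subsets of a Euclidean space as Riemannian submanifolds

Everything is stated for a subset `M` of a Euclidean space `E`; it is meant for the case that `M` is
an embedded submanifold carrying the metric of `E`. Maps on `M` or on its tangent bundle are
represented by total maps; only their values on `M`, resp. on the tangent bundle, are used. -/

variable {E : Type*} [NormedAddCommGroup E] [InnerProductSpace ℝ E]

/-- `c` is a curve on `M` through `x` at time `0` that is smooth around `0`. -/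
def IsSmoothCurveAt (M : Set E) (x : E) (c : ℝ → E) : Prop :=
  c 0 = x ∧ ∃ ε > 0, ContDiffOn ℝ ∞ c (Ioo (-ε) ε) ∧ ∀ t ∈ Ioo (-ε) ε, c t ∈ M

/-- The tangent space `T_x M`: velocities at `0` of the smooth curves on `M` through `x`. -/
def tangentSpaceAt (M : Set E) (x : E) : Set E :=
  {v | ∃ c : ℝ → E, IsSmoothCurveAt M x c ∧ HasDerivAt c v 0}

/-- The tangent bundle `TM`, as a subset of `E × E`. -/
def tangentBundle (M : Set E) : Set (E × E) :=
  {p | p.1 ∈ M ∧ p.2 ∈ tangentSpaceAt M p.1}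

/-- `R : TM → M` is a retraction: it is smooth (near each point of `TM` it agrees on `TM` with a
smooth map on an open subset of the ambient space), and each curve `t ↦ R x (t v)` starts at `x`
with velocity `v`. -/
structure IsRetraction (M : Set E) (R : E → E → E) : Prop where
  mapsTo : ∀ x ∈ M, ∀ v ∈ tangentSpaceAt M x, R x v ∈ M
  smooth : ∀ p ∈ tangentBundle M, ∃ U : Set (E × E), IsOpen U ∧ p ∈ U ∧
    ∃ Rbar : E × E → E, ContDiffOn ℝ ∞ Rbar U ∧
      ∀ q ∈ U ∩ tangentBundle M, Rbar q = R q.1 q.2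
  zero : ∀ x ∈ M, R x 0 = x
  deriv_zero : ∀ x ∈ M, ∀ v ∈ tangentSpaceAt M x, HasDerivAt (fun t : ℝ => R x (t • v)) v 0

/-- `g` is the Riemannian gradient of `h : M → ℝ` at `x`: the tangent vector that represents the
differential of `h`, which is computed along smooth curves on `M`. -/
def IsRiemannianGradient (M : Set E) (h : E → ℝ) (x g : E) : Prop :=
  g ∈ tangentSpaceAt M x ∧
    ∀ (c : ℝ → E) (v : E), IsSmoothCurveAt M x c → HasDerivAt c v 0 →
      HasDerivAt (fun t => h (c t)) (inner ℝ v g) 0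

/-- `h : M → ℝ` has a gradient Lipschitz retraction with constant `L` with respect to `R`; the
existence of the Riemannian gradient of `h` is part of the condition. -/
def HasGradLipRetraction (M : Set E) (R : E → E → E) (h : E → ℝ) (L : ℝ) : Prop :=
  ∀ x ∈ M, ∃ g, IsRiemannianGradient M h x g ∧
    ∀ v ∈ tangentSpaceAt M x, h (R x v) ≤ h x + inner ℝ g v + L / 2 * ‖v‖ ^ 2

/-- `γ` is a geodesic of the Riemannian submanifold `M` defined for all times: a smooth curve on `M`
whose acceleration in `E` is everywhere orthogonal to `M`. -/
structure IsGeodesic (M : Set E) (γ : ℝ → E) : Prop where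
  smooth : ContDiff ℝ ∞ γ
  mem : ∀ t, γ t ∈ M
  normal : ∀ t, ∀ w ∈ tangentSpaceAt M (γ t), inner ℝ (deriv (deriv γ) t) w = 0

/-- `γ` is a geodesic with initial position `x` and initial velocity `v`. -/
def IsGeodesicFrom (M : Set E) (x v : E) (γ : ℝ → E) : Prop :=
  IsGeodesic M γ ∧ γ 0 = x ∧ deriv γ 0 = v

open Classical in
/-- The Riemannian exponential map of a geodesically complete submanifold: `Exp x v = γ 1` for the
geodesic `γ` with `γ 0 = x` and `γ' 0 = v` (and `x` where there is none; for the orthogonal group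
see `exists_geodesic` and `geodesic_unique` below). -/
noncomputable def riemannianExp (M : Set E) (x v : E) : E :=
  if h : ∃ γ : ℝ → E, IsGeodesicFrom M x v γ then h.choose 1 else x

/-- The Lipschitz conditions on `f : M × C → ℝ`, where `C` is a set of parameters `y` and `R` is the
retraction in use. Gradients in `y` are those of `f x` on the whole space `Y`. -/
structure LipschitzConditions {Y : Type*} [NormedAddCommGroup Y] [InnerProductSpace ℝ Y]
    [CompleteSpace Y] (M : Set E) (C : Set Y) (R : E → E → E) (f : E → Y → ℝ) : Prop where
  differentiable : ∀ x ∈ M, ∀ y ∈ C, DifferentiableAt ℝ (f x) y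
  grad_y : ∃ Ly : ℝ, 0 ≤ Ly ∧ ∀ x ∈ M, ∀ y₁ ∈ C, ∀ y₂ ∈ C,
    ‖∇ (f x) y₁ - ∇ (f x) y₂‖ ≤ Ly * ‖y₁ - y₂‖
  grad_x : ∃ Lx : ℝ, 1 ≤ Lx ∧ ∀ y ∈ C,
    HasGradLipRetraction M (riemannianExp M) (fun x => f x y) Lx ∧
    HasGradLipRetraction M R (fun x => f x y) Lx
  grad_xy : ∃ Lxy : ℝ, 0 ≤ Lxy ∧ ∀ x₁ ∈ M, ∀ x₂ ∈ M, ∀ y ∈ C,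
    ‖∇ (f x₁) y - ∇ (f x₂) y‖ ≤ Lxy * ‖x₁ - x₂‖

end Submanifold

section Matrices

/-- The Frobenius inner product `⟨A, B⟩ = tr (Aᵀ B)`, which induces the Frobenius norm. -/
noncomputable instance frobeniusInnerProductSpace (n : ℕ) :
    InnerProductSpace ℝ (Matrix (Fin n) (Fin n) ℝ) where
  inner A B := (A.transpose * B).trace
  norm_sq_eq_re_inner A := by
    have h : 0 ≤ ∑ i, ∑ j, ‖A i j‖ ^ (2 : ℝ) := by positivity
    rw [Matrix.frobenius_norm_def, ← Real.sqrt_eq_rpow, Real.sq_sqrt h]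
    simp only [Matrix.trace, Matrix.diag, Matrix.mul_apply, Matrix.transpose_apply,
      RCLike.re_to_real]
    rw [Finset.sum_comm]
    refine Finset.sum_congr rfl fun i _ => Finset.sum_congr rfl fun j _ => ?_
    rw [Real.rpow_two, Real.norm_eq_abs, sq_abs, sq]
  conj_inner_symm A B := by
    rw [conj_trivial, ← Matrix.trace_transpose, Matrix.transpose_mul, Matrix.transpose_transpose]
  add_left A B C := by
    simp [Matrix.add_mul]
  smul_left A B r := by
    simp

/-- The space of real symmetric `n × n` matrices, with the Frobenius inner product. -/
def symMatrix (n : ℕ) : Submodule ℝ (Matrix (Fin n) (Fin n) ℝ) where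
  carrier := {A | A.IsSymm}
  add_mem' hA hB := hA.add hB
  zero_mem' := Matrix.isSymm_zero
  smul_mem' r _ hA := hA.smul r

/-- The manifold of orthogonal `n × n` matrices. -/
def orthogonalMatrices (n : ℕ) : Set (Matrix (Fin n) (Fin n) ℝ) :=
  (Matrix.orthogonalGroup (Fin n) ℝ : Set (Matrix (Fin n) (Fin n) ℝ))

/-- The symmetric matrix `U Diag(l) Uᵀ`. -/
def conjDiag {n : ℕ} (U : Matrix (Fin n) (Fin n) ℝ) (l : EuclideanSpace ℝ (Fin n)) :
    symMatrix n :=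
  ⟨U * Matrix.diagonal (fun i => l i) * U.transpose, by
    simp [symMatrix, Matrix.IsSymm, Matrix.mul_assoc]⟩

/-- `f(U, l) = F(U Diag(l) Uᵀ)`; the formula makes sense for every square matrix `U`. -/
def spectralObjective {n : ℕ} (F : symMatrix n → ℝ) (U : Matrix (Fin n) (Fin n) ℝ)
    (l : EuclideanSpace ℝ (Fin n)) : ℝ :=
  F (conjDiag U l)

end Matrices

section Geodesics

/-! ### The exponential map of the orthogonal group is well defined -/

attribute [local instance] Matrix.frobeniusNormedRing Matrix.frobeniusNormedAlgebra

open Matrix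

variable {n : ℕ}

theorem inner_eq_trace (A B : Matrix (Fin n) (Fin n) ℝ) : inner ℝ A B = (Aᵀ * B).trace := rfl

theorem hasDerivAt_transpose {c : ℝ → Matrix (Fin n) (Fin n) ℝ} {v : Matrix (Fin n) (Fin n) ℝ}
    {t : ℝ} (h : HasDerivAt c v t) : HasDerivAt (fun s => (c s)ᵀ) vᵀ t :=
  (LinearMap.toContinuousLinearMap
    (Matrix.transposeLinearEquiv (Fin n) (Fin n) ℝ ℝ).toLinearMap).hasFDerivAt.comp_hasDerivAt t h

theorem mem_orthogonalMatrices {Q : Matrix (Fin n) (Fin n) ℝ} :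
    Q ∈ orthogonalMatrices n ↔ Qᵀ * Q = 1 :=
  Matrix.mem_orthogonalGroup_iff' (Fin n) ℝ

theorem mul_transpose_of_mem {Q : Matrix (Fin n) (Fin n) ℝ} (hQ : Q ∈ orthogonalMatrices n) :
    Q * Qᵀ = 1 :=
  (Matrix.mem_orthogonalGroup_iff (Fin n) ℝ).1 hQ

theorem transpose_mul_skew {Q v : Matrix (Fin n) (Fin n) ℝ}
    (hv : v ∈ tangentSpaceAt (orthogonalMatrices n) Q) : (Qᵀ * v)ᵀ = -(Qᵀ * v) := by
  obtain ⟨c, ⟨h0, ε, hε, -, hc⟩, hd⟩ := hv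
  have h1 := (hasDerivAt_transpose hd).mul hd
  have h2 : (fun t => (c t)ᵀ * c t) =ᶠ[𝓝 0] fun _ => 1 := by
    filter_upwards [Ioo_mem_nhds (neg_lt_zero.2 hε) hε] with t ht
    exact mem_orthogonalMatrices.1 (hc t ht)
  have h3 := h1.unique ((hasDerivAt_const (0 : ℝ)
    (1 : Matrix (Fin n) (Fin n) ℝ)).congr_of_eventuallyEq h2)
  rw [h0] at h3
  rw [Matrix.transpose_mul, Matrix.transpose_transpose]
  exact eq_neg_of_add_eq_zero_left h3

theorem exp_skew_mem {A : Matrix (Fin n) (Fin n) ℝ} (hA : Aᵀ = -A) (t : ℝ) :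
    NormedSpace.exp (t • A) ∈ orthogonalMatrices n := by
  rw [mem_orthogonalMatrices, ← Matrix.exp_transpose, Matrix.transpose_smul, hA, smul_neg,
    ← Matrix.exp_add_of_commute _ _ ((Commute.refl (t • A)).neg_left), neg_add_cancel,
    NormedSpace.exp_zero]

theorem mul_mem_orthogonal {P Q : Matrix (Fin n) (Fin n) ℝ} (hP : P ∈ orthogonalMatrices n)
    (hQ : Q ∈ orthogonalMatrices n) : P * Q ∈ orthogonalMatrices n :=
  (Matrix.orthogonalGroup (Fin n) ℝ).mul_mem hP hQ

theorem hasDerivAt_mul_exp (Q A : Matrix (Fin n) (Fin n) ℝ) (t : ℝ) :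
    HasDerivAt (fun s : ℝ => Q * NormedSpace.exp (s • A)) (Q * NormedSpace.exp (t • A) * A) t := by
  have h := (hasDerivAt_exp_smul_const (𝕂 := ℝ) A t).const_mul Q
  rwa [← mul_assoc] at h

theorem contDiff_mul_exp (Q A : Matrix (Fin n) (Fin n) ℝ) :
    ContDiff ℝ ∞ (fun s : ℝ => Q * NormedSpace.exp (s • A)) := by
  have h : ContDiff ℝ ∞ (NormedSpace.exp : Matrix (Fin n) (Fin n) ℝ → _) :=
    contDiff_iff_contDiffAt.2 fun x => (NormedSpace.exp_analytic (𝕂 := ℝ) x).contDiffAt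
  exact contDiff_const.mul (h.comp (contDiff_id.smul contDiff_const))

theorem mul_skew_mem_tangent {Q A : Matrix (Fin n) (Fin n) ℝ} (hQ : Q ∈ orthogonalMatrices n)
    (hA : Aᵀ = -A) : Q * A ∈ tangentSpaceAt (orthogonalMatrices n) Q := by
  refine ⟨fun s => Q * NormedSpace.exp (s • A), ⟨by simp, 1, one_pos,
    (contDiff_mul_exp Q A).contDiffOn, fun t _ => mul_mem_orthogonal hQ (exp_skew_mem hA t)⟩, ?_⟩
  have h := hasDerivAt_mul_exp Q A 0
  rw [zero_smul, NormedSpace.exp_zero, mul_one] at h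
  exact h

theorem exists_geodesic {Q v : Matrix (Fin n) (Fin n) ℝ} (hQ : Q ∈ orthogonalMatrices n)
    (hv : v ∈ tangentSpaceAt (orthogonalMatrices n) Q) :
    ∃ γ, IsGeodesicFrom (orthogonalMatrices n) Q v γ := by
  have hA := transpose_mul_skew hv
  set A := Qᵀ * v with hAdef
  have hd : deriv (fun s : ℝ => Q * NormedSpace.exp (s • A)) =
      fun t => Q * NormedSpace.exp (t • A) * A := funext fun t => (hasDerivAt_mul_exp Q A t).deriv
  have hdd : ∀ t, deriv (deriv (fun s : ℝ => Q * NormedSpace.exp (s • A))) t =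
      Q * NormedSpace.exp (t • A) * A * A := fun t => by
    rw [hd]
    exact ((hasDerivAt_mul_exp Q A t).mul_const A).deriv
  have hd0 : deriv (fun s : ℝ => Q * NormedSpace.exp (s • A)) 0 = v := by
    rw [hd]
    simp [hAdef, ← Matrix.mul_assoc, mul_transpose_of_mem hQ]
  refine ⟨fun s => Q * NormedSpace.exp (s • A), ⟨contDiff_mul_exp Q A,
    fun t => mul_mem_orthogonal hQ (exp_skew_mem hA t), fun t w hw => ?_⟩, by simp, hd0⟩
  · have hB := transpose_mul_skew hw
    refine Eq.trans (congrArg (fun X => inner ℝ X w) (hdd t)) ?_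
    rw [inner_eq_trace]
    set P := Q * NormedSpace.exp (t • A)
    set B := Pᵀ * w with hBdef
    have h1 : (P * A * A)ᵀ * w = A * A * B := by
      simp [Matrix.transpose_mul, hA, Matrix.mul_assoc, hBdef]
    have h2 : (A * A * B).trace = -(A * A * B).trace := by
      conv_lhs => rw [← Matrix.trace_transpose]
      rw [Matrix.transpose_mul (A * A) B, Matrix.transpose_mul A A, hA, hB,
        Matrix.trace_mul_comm (A * A) B]
      simp
    rw [h1]
    linarith

theorem isSymm_of_trace_skew {S : Matrix (Fin n) (Fin n) ℝ}
    (h : ∀ B : Matrix (Fin n) (Fin n) ℝ, Bᵀ = -B → (Sᵀ * B).trace = 0) : Sᵀ = S := by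
  have h1 := h (S - Sᵀ) (by simp)
  have h2 : (S * (S - Sᵀ)).trace = -(Sᵀ * (S - Sᵀ)).trace := by
    rw [← Matrix.trace_transpose, Matrix.transpose_mul, Matrix.trace_mul_comm,
      ← Matrix.trace_neg, ← Matrix.mul_neg]
    simp
  have h3 : inner ℝ (S - Sᵀ) (S - Sᵀ) = 0 := by
    rw [inner_eq_trace, Matrix.transpose_sub, Matrix.transpose_transpose, Matrix.sub_mul,
      Matrix.trace_sub, h2, h1]
    simp
  exact (sub_eq_zero.1 (inner_self_eq_zero.1 h3)).symm

theorem geodesic_eq {Q v : Matrix (Fin n) (Fin n) ℝ} {γ : ℝ → Matrix (Fin n) (Fin n) ℝ}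
    (h : IsGeodesicFrom (orthogonalMatrices n) Q v γ) (t : ℝ) :
    γ t = Q * NormedSpace.exp (t • (Qᵀ * v)) := by
  obtain ⟨⟨hs, hm, hn⟩, h0, hv⟩ := h
  have hd : ∀ t, HasDerivAt γ (deriv γ t) t := fun t =>
    (hs.differentiable (by simp) t).hasDerivAt
  have hdd : ∀ t, HasDerivAt (deriv γ) (deriv (deriv γ) t) t := fun t =>
    (((contDiff_infty_iff_deriv.1 hs).2).differentiable (by simp) t).hasDerivAt
  have htan : ∀ t, deriv γ t ∈ tangentSpaceAt (orthogonalMatrices n) (γ t) := fun t =>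
    ⟨fun s => γ (t + s), ⟨by simp, 1, one_pos,
      (hs.comp (contDiff_const.add contDiff_id)).contDiffOn, fun s _ => hm _⟩,
      HasDerivAt.comp_const_add t 0 (by rw [add_zero]; exact hd t)⟩
  have hA : ∀ t, HasDerivAt (fun s => (γ s)ᵀ * deriv γ s)
      ((deriv γ t)ᵀ * deriv γ t + (γ t)ᵀ * deriv (deriv γ) t) t := fun t =>
    (hasDerivAt_transpose (hd t)).mul (hdd t)
  have hsymm : ∀ t, ((γ t)ᵀ * deriv (deriv γ) t)ᵀ = (γ t)ᵀ * deriv (deriv γ) t := fun t => by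
    refine isSymm_of_trace_skew fun B hB => ?_
    rw [Matrix.transpose_mul, Matrix.transpose_transpose, Matrix.mul_assoc]
    exact hn t _ (mul_skew_mem_tangent (hm t) hB)
  have hskew : ∀ t, ((deriv γ t)ᵀ * deriv γ t + (γ t)ᵀ * deriv (deriv γ) t)ᵀ =
      -((deriv γ t)ᵀ * deriv γ t + (γ t)ᵀ * deriv (deriv γ) t) := fun t => by
    have h1 := hasDerivAt_transpose (hA t)
    have h2 : (fun s => ((γ s)ᵀ * deriv γ s)ᵀ) = fun s => -((γ s)ᵀ * deriv γ s) :=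
      funext fun s => transpose_mul_skew (htan s)
    rw [h2] at h1
    exact h1.unique (hA t).neg
  have hzero : ∀ t, (deriv γ t)ᵀ * deriv γ t + (γ t)ᵀ * deriv (deriv γ) t = 0 := fun t => by
    have h1 := hskew t
    rw [Matrix.transpose_add, hsymm t, Matrix.transpose_mul, Matrix.transpose_transpose] at h1
    ext i j
    have h2 := congrFun (congrFun h1 i) j
    rw [Matrix.neg_apply] at h2
    rw [Matrix.zero_apply]
    linarith
  have hconst : ∀ t, (γ t)ᵀ * deriv γ t = Qᵀ * v := fun t => by
    have := is_const_of_deriv_eq_zero (fun s => (hA s).differentiableAt)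
      (fun s => by rw [(hA s).deriv, hzero s]) t 0
    rw [h0] at this
    exact this.trans (congrArg (fun X => Qᵀ * X) hv)
  set A := Qᵀ * v
  have hγ : ∀ t, deriv γ t = γ t * A := fun t => by
    rw [← hconst t, ← Matrix.mul_assoc, mul_transpose_of_mem (hm t), Matrix.one_mul]
  have hE : ∀ t, HasDerivAt (fun s : ℝ => γ s * NormedSpace.exp (s • (-A))) 0 t := fun t => by
    have h1 := (hd t).mul (hasDerivAt_exp_smul_const' (𝕂 := ℝ) (-A) t)
    have h2 : deriv γ t * NormedSpace.exp (t • (-A)) +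
        γ t * (-A * NormedSpace.exp (t • (-A))) = 0 := by
      rw [hγ t, Matrix.mul_assoc, ← Matrix.mul_add, Matrix.neg_mul, add_neg_cancel,
        Matrix.mul_zero]
    exact h2 ▸ h1
  have h3 := is_const_of_deriv_eq_zero (fun s => (hE s).differentiableAt)
    (fun s => (hE s).deriv) t 0
  have h4 : NormedSpace.exp (t • (-A)) * NormedSpace.exp (t • A) = 1 := by
    rw [smul_neg, ← Matrix.exp_add_of_commute _ _ ((Commute.refl (t • A)).neg_left),
      neg_add_cancel, NormedSpace.exp_zero]
  have h5 : γ t * NormedSpace.exp (t • (-A)) = Q := by simpa [h0] using h3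
  rw [← h5, Matrix.mul_assoc, h4, Matrix.mul_one]

theorem geodesic_unique {Q v : Matrix (Fin n) (Fin n) ℝ} {γ₁ γ₂ : ℝ → Matrix (Fin n) (Fin n) ℝ}
    (h₁ : IsGeodesicFrom (orthogonalMatrices n) Q v γ₁)
    (h₂ : IsGeodesicFrom (orthogonalMatrices n) Q v γ₂) : γ₁ = γ₂ :=
  funext fun t => (geodesic_eq h₁ t).trans (geodesic_eq h₂ t).symm

end Geodesics

end SpectralLip

/-!
The map `(U, l) ↦ U Diag(l) Uᵀ` is a polynomial, so composing it with `F`, whose derivative is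
Lipschitz, gives an `f` whose full derivative is Lipschitz on bounded sets, in particular on
`conv O(n) × C`. Hence so are both of its partial gradients.

A retraction on a compact `M` satisfies `‖R x v - x‖ ≤ a ‖v‖` and `‖R x v - x - v‖ ≤ b ‖v‖²`: for
small `v` by Taylor expansion along `TM` and compactness, and for large `v` since `M` is bounded.
Inserting both into the descent inequality on `conv M` bounds `f(R x v) - f x - ⟨grad f x, v⟩` by a
multiple of `‖v‖²`. The exponential map of `O(n)` is the retraction `(Q, V) ↦ Q exp(Qᵀ V)`.

For orthogonal `Q` the map `l ↦ Q Diag(l) Qᵀ` is a linear isometry, so `∇_l f(Q, ·)` even has the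
Lipschitz constant of `∇F`.
-/

namespace SpectralLip

open Asymptotics Bornology Function
open scoped NNReal

section LipschitzOnWith

variable {X Y : Type*} {K : ℝ≥0} {f g : X → Y} {s : Set X}

theorem lipschitzOnWith_of_eqOn [PseudoEMetricSpace X] [PseudoEMetricSpace Y]
    (hf : LipschitzOnWith K f s) (hgf : EqOn g f s) :
    LipschitzOnWith K g s := fun x hx y hy => by
  rw [hgf hx, hgf hy]
  exact hf hx hy

theorem exists_norm_le_of_lipschitzOnWith [PseudoMetricSpace X] [SeminormedAddCommGroup Y]
    (hf : LipschitzOnWith K f s) (hs : IsBounded s) : ∃ B : ℝ≥0, ∀ x ∈ s, ‖f x‖ ≤ B := by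
  have hbdd : IsBounded (f '' s) := by
    refine Metric.isBounded_image_iff.2 ⟨K * Metric.diam s, fun x hx y hy => ?_⟩
    exact (hf.dist_le_mul x hx y hy).trans
      (mul_le_mul_of_nonneg_left (Metric.dist_le_diam_of_mem hs hx hy) K.coe_nonneg)
  obtain ⟨B, hB, hle⟩ := hbdd.exists_pos_norm_le
  exact ⟨⟨B, hB.le⟩, fun x hx => hle _ (mem_image_of_mem f hx)⟩

end LipschitzOnWith

section C11

variable {E F G : Type*} [NormedAddCommGroup E] [NormedSpace ℝ E] [NormedAddCommGroup F]
  [NormedSpace ℝ F] [NormedAddCommGroup G] [NormedSpace ℝ G]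

/-- `f` is of class `C^{1,1}` on `s`: it is differentiable at the points of `s` and its derivative
is Lipschitz on `s`. Derivatives are those of `f` on the whole space, also at boundary points. -/
structure IsC11On (f : E → F) (s : Set E) : Prop where
  differentiableAt : ∀ x ∈ s, DifferentiableAt ℝ f x
  exists_lipschitzOnWith_fderiv : ∃ K : ℝ≥0, LipschitzOnWith K (fderiv ℝ f) s

theorem IsC11On.of_contDiff {f : E → F} {s : Set E} (hf : ContDiff ℝ 2 f) (hs : Convex ℝ s)
    (hs' : IsCompact s) : IsC11On f s where
  differentiableAt x _ := hf.differentiable two_ne_zero x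
  exists_lipschitzOnWith_fderiv :=
    (hf.fderiv_right (m := 1) le_rfl).contDiffOn.exists_lipschitzOnWith one_ne_zero hs hs'

theorem IsC11On.mono {f : E → F} {s t : Set E} (hf : IsC11On f t) (hst : s ⊆ t) :
    IsC11On f s where
  differentiableAt x hx := hf.differentiableAt x (hst hx)
  exists_lipschitzOnWith_fderiv := hf.exists_lipschitzOnWith_fderiv.imp fun _ hK => hK.mono hst

theorem IsC11On.exists_norm_fderiv_le {f : E → F} {s : Set E} (hf : IsC11On f s)
    (hs : IsBounded s) : ∃ B : ℝ≥0, ∀ x ∈ s, ‖fderiv ℝ f x‖ ≤ B :=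
  have ⟨_, hK⟩ := hf.exists_lipschitzOnWith_fderiv
  exists_norm_le_of_lipschitzOnWith hK hs

theorem IsC11On.exists_lipschitzOnWith {f : E → F} {s : Set E} (hf : IsC11On f s)
    (hs : Convex ℝ s) (hs' : IsBounded s) : ∃ K : ℝ≥0, LipschitzOnWith K f s :=
  have ⟨B, hB⟩ := hf.exists_norm_fderiv_le hs'
  ⟨B, hs.lipschitzOnWith_of_nnnorm_fderiv_le hf.differentiableAt hB⟩

theorem norm_comp_sub_comp_le (a a' : F →L[ℝ] G) (b b' : E →L[ℝ] F) :
    ‖a.comp b - a'.comp b'‖ ≤ ‖a - a'‖ * ‖b‖ + ‖a'‖ * ‖b - b'‖ := by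
  have hsplit : a.comp b - a'.comp b' = (a - a').comp b + a'.comp (b - b') := by
    rw [ContinuousLinearMap.sub_comp, ContinuousLinearMap.comp_sub, sub_add_sub_cancel]
  rw [hsplit]
  exact (norm_add_le _ _).trans (add_le_add (ContinuousLinearMap.opNorm_comp_le _ _)
    (ContinuousLinearMap.opNorm_comp_le _ _))

theorem exists_lipschitzOnWith_clm_comp {X : Type*} [PseudoMetricSpace X] {s : Set X}
    {a : X → F →L[ℝ] G} {b : X → E →L[ℝ] F} {Ka Kb : ℝ≥0} (hs : IsBounded s)
    (ha : LipschitzOnWith Ka a s) (hb : LipschitzOnWith Kb b s) :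
    ∃ K : ℝ≥0, LipschitzOnWith K (fun x => (a x).comp (b x)) s := by
  obtain ⟨A, hA⟩ := exists_norm_le_of_lipschitzOnWith ha hs
  obtain ⟨B, hB⟩ := exists_norm_le_of_lipschitzOnWith hb hs
  refine ⟨Ka * B + A * Kb, LipschitzOnWith.of_dist_le_mul fun x hx y hy => ?_⟩
  have hax := ha.dist_le_mul x hx y hy
  have hbx := hb.dist_le_mul x hx y hy
  rw [dist_eq_norm] at hax hbx ⊢
  calc ‖(a x).comp (b x) - (a y).comp (b y)‖
      ≤ ‖a x - a y‖ * ‖b x‖ + ‖a y‖ * ‖b x - b y‖ := norm_comp_sub_comp_le _ _ _ _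
    _ ≤ Ka * dist x y * B + A * (Kb * dist x y) := by
        gcongr
        exacts [hB x hx, hA y hy]
    _ = ↑(Ka * B + A * Kb) * dist x y := by push_cast; ring

theorem IsC11On.comp {g : F → G} {f : E → F} {s : Set E} {t : Set F} (hg : IsC11On g t)
    (hf : IsC11On f s) (hst : MapsTo f s t) (hs : Convex ℝ s) (hs' : IsBounded s) :
    IsC11On (g ∘ f) s where
  differentiableAt x hx :=
    (hg.differentiableAt _ (hst hx)).comp x (hf.differentiableAt x hx)
  exists_lipschitzOnWith_fderiv := by
    obtain ⟨Kg, hKg⟩ := hg.exists_lipschitzOnWith_fderiv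
    obtain ⟨Kf, hKf⟩ := hf.exists_lipschitzOnWith_fderiv
    obtain ⟨K, hK⟩ := hf.exists_lipschitzOnWith hs hs'
    obtain ⟨K', hK'⟩ := exists_lipschitzOnWith_clm_comp hs' (hKg.comp hK hst) hKf
    exact ⟨K', lipschitzOnWith_of_eqOn hK' fun x hx =>
      fderiv_comp x (hg.differentiableAt _ (hst hx)) (hf.differentiableAt x hx)⟩

theorem norm_image_sub_sub_fderiv_le {f : E → F} {s : Set E} {K : ℝ≥0} (hs : Convex ℝ s)
    (hf : ∀ x ∈ s, DifferentiableAt ℝ f x) (hK : LipschitzOnWith K (fderiv ℝ f) s) {x y : E}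
    (hx : x ∈ s) (hy : y ∈ s) : ‖f y - f x - fderiv ℝ f x (y - x)‖ ≤ K * ‖y - x‖ ^ 2 := by
  have hseg : segment ℝ x y ⊆ s := hs.segment_subset hx hy
  have hbound : ∀ z ∈ segment ℝ x y, ‖fderiv ℝ f z - fderiv ℝ f x‖ ≤ K * ‖y - x‖ := fun z hz =>
    (hK.norm_sub_le (hseg hz) hx).trans
      (mul_le_mul_of_nonneg_left (norm_sub_le_of_mem_segment hz) K.coe_nonneg)
  rw [sq, ← mul_assoc]
  exact (convex_segment x y).norm_image_sub_le_of_norm_fderiv_le' (fun z hz => hf z (hseg hz))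
    hbound (left_mem_segment ℝ x y) (right_mem_segment ℝ x y)

theorem isBigO_image_sub_sub_fderiv {f : E → F} {x : E} (hf : ContDiffAt ℝ 2 f x) :
    (fun p : E × E => f p.2 - f p.1 - fderiv ℝ f p.1 (p.2 - p.1)) =O[𝓝 (x, x)]
      fun p => ‖p.2 - p.1‖ ^ 2 := by
  obtain ⟨K, s, hs, hK⟩ :=
    (hf.fderiv_right (m := 1) le_rfl).exists_lipschitzOnWith
  have hdiff : ∀ᶠ y in 𝓝 x, DifferentiableAt ℝ f y :=
    (hf.eventually (by simp)).mono fun y hy => hy.differentiableAt two_ne_zero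
  obtain ⟨ε, hε, hball⟩ := Metric.mem_nhds_iff.1 (inter_mem hs hdiff)
  refine IsBigO.of_bound K ?_
  filter_upwards [prod_mem_nhds (Metric.ball_mem_nhds x hε) (Metric.ball_mem_nhds x hε)] with p hp
  rw [norm_pow, norm_norm]
  exact norm_image_sub_sub_fderiv_le (convex_ball x ε) (fun y hy => (hball hy).2)
    (hK.mono fun y hy => (hball hy).1) hp.1 hp.2

section Partial

variable {f : E → F → G}

theorem hasFDerivAt_partial_right {x : E} {y : F} (hf : DifferentiableAt ℝ (uncurry f) (x, y)) :
    HasFDerivAt (f x) ((fderiv ℝ (uncurry f) (x, y)).comp (.inr ℝ E F)) y :=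
  HasFDerivAt.comp (f := Prod.mk x) y hf.hasFDerivAt (hasFDerivAt_prodMk_right x y)

theorem hasFDerivAt_partial_left {x : E} {y : F} (hf : DifferentiableAt ℝ (uncurry f) (x, y)) :
    HasFDerivAt (fun x' => f x' y) ((fderiv ℝ (uncurry f) (x, y)).comp (.inl ℝ E F)) x :=
  HasFDerivAt.comp (f := fun x' => (x', y)) x hf.hasFDerivAt (hasFDerivAt_prodMk_left x y)

theorem IsC11On.exists_lipschitzOnWith_fderiv_right {s : Set (E × F)}
    (hf : IsC11On (uncurry f) s) :
    ∃ K : ℝ≥0, LipschitzOnWith K (fun p : E × F => fderiv ℝ (f p.1) p.2) s := by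
  obtain ⟨K, hK⟩ := hf.exists_lipschitzOnWith_fderiv
  have hcomp := ((ContinuousLinearMap.inr ℝ E F).precomp G).lipschitz.comp_lipschitzOnWith hK
  exact ⟨_, lipschitzOnWith_of_eqOn hcomp fun p hp =>
    (hasFDerivAt_partial_right (hf.differentiableAt p hp)).fderiv⟩

theorem IsC11On.exists_lipschitzOnWith_fderiv_left {s : Set (E × F)}
    (hf : IsC11On (uncurry f) s) :
    ∃ K : ℝ≥0, LipschitzOnWith K (fun p : E × F => fderiv ℝ (fun x => f x p.2) p.1) s := by
  obtain ⟨K, hK⟩ := hf.exists_lipschitzOnWith_fderiv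
  have hcomp := ((ContinuousLinearMap.inl ℝ E F).precomp G).lipschitz.comp_lipschitzOnWith hK
  exact ⟨_, lipschitzOnWith_of_eqOn hcomp fun p hp =>
    (hasFDerivAt_partial_left (hf.differentiableAt p hp)).fderiv⟩

end Partial

end C11

section Gradient

variable {E H : Type*} [NormedAddCommGroup E] [NormedAddCommGroup H] [InnerProductSpace ℝ H]
  [CompleteSpace H]

theorem norm_gradient_sub (f g : H → ℝ) (x y : H) :
    ‖∇ f x - ∇ g y‖ = ‖fderiv ℝ f x - fderiv ℝ g y‖ := by
  rw [gradient, gradient, ← map_sub, LinearIsometryEquiv.norm_map]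

theorem IsC11On.of_norm_gradient_sub_le {f : H → ℝ} {s : Set H} {L : ℝ}
    (hf : ∀ x ∈ s, DifferentiableAt ℝ f x)
    (hL : ∀ x ∈ s, ∀ y ∈ s, ‖∇ f x - ∇ f y‖ ≤ L * ‖x - y‖) : IsC11On f s where
  differentiableAt := hf
  exists_lipschitzOnWith_fderiv := ⟨L.toNNReal, lipschitzOnWith_iff_norm_sub_le.2 fun x hx y hy =>
    (norm_gradient_sub f f x y).symm.trans_le
      ((hL x hx y hy).trans (by gcongr; exact L.le_coe_toNNReal))⟩

theorem IsC11On.exists_norm_gradient_left_sub_le [NormedSpace ℝ E] {f : H → E → ℝ} {s : Set H}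
    {t : Set E} (hf : IsC11On (uncurry f) (s ×ˢ t)) :
    ∃ L : ℝ, 0 ≤ L ∧ ∀ y ∈ t, ∀ x₁ ∈ s, ∀ x₂ ∈ s,
      ‖∇ (fun x => f x y) x₁ - ∇ (fun x => f x y) x₂‖ ≤ L * ‖x₁ - x₂‖ := by
  obtain ⟨K, hK⟩ := hf.exists_lipschitzOnWith_fderiv_left
  refine ⟨K, K.coe_nonneg, fun y hy x₁ hx₁ x₂ hx₂ => ?_⟩
  rw [norm_gradient_sub]
  simpa using hK.norm_sub_le (mk_mem_prod hx₁ hy) (mk_mem_prod hx₂ hy)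

theorem IsC11On.exists_norm_gradient_right_sub_le [NormedSpace ℝ E] {f : E → H → ℝ} {s : Set E}
    {t : Set H} (hf : IsC11On (uncurry f) (s ×ˢ t)) :
    ∃ L : ℝ, 0 ≤ L ∧ ∀ x₁ ∈ s, ∀ x₂ ∈ s, ∀ y₁ ∈ t, ∀ y₂ ∈ t,
      ‖∇ (f x₁) y₁ - ∇ (f x₂) y₂‖ ≤ L * max ‖x₁ - x₂‖ ‖y₁ - y₂‖ := by
  obtain ⟨K, hK⟩ := hf.exists_lipschitzOnWith_fderiv_right
  refine ⟨K, K.coe_nonneg, fun x₁ hx₁ x₂ hx₂ y₁ hy₁ y₂ hy₂ => ?_⟩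
  rw [norm_gradient_sub]
  simpa only [Prod.mk_sub_mk, Prod.norm_mk] using
    hK.norm_sub_le (mk_mem_prod hx₁ hy₁) (mk_mem_prod hx₂ hy₂)

theorem norm_gradient_comp_linearIsometry_sub_le [InnerProductSpace ℝ E] [CompleteSpace E]
    {f : H → ℝ} (hf : Differentiable ℝ f) (T : E →ₗᵢ[ℝ] H) (x y : E) :
    ‖∇ (f ∘ T) x - ∇ (f ∘ T) y‖ ≤ ‖∇ f (T x) - ∇ f (T y)‖ := by
  have hfderiv : ∀ z, fderiv ℝ (f ∘ T) z = (fderiv ℝ f (T z)).comp T.toContinuousLinearMap :=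
    fun z => ((hf (T z)).hasFDerivAt.comp z T.toContinuousLinearMap.hasFDerivAt).fderiv
  rw [norm_gradient_sub, norm_gradient_sub, hfderiv, hfderiv, ← ContinuousLinearMap.sub_comp]
  exact (ContinuousLinearMap.opNorm_comp_le _ _).trans
    (mul_le_of_le_one_right (norm_nonneg _) T.norm_toContinuousLinearMap_le)

end Gradient

section Retraction

variable {E : Type*} [NormedAddCommGroup E] [InnerProductSpace ℝ E] {M : Set E} {R : E → E → E}
  {x v : E}

theorem smul_mem_tangentSpaceAt (hv : v ∈ tangentSpaceAt M x) (a : ℝ) :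
    a • v ∈ tangentSpaceAt M x := by
  obtain ⟨c, ⟨h0, ε, hε, hc, hcM⟩, hd⟩ := hv
  have hnear : ∀ᶠ t : ℝ in 𝓝 0, a * t ∈ Ioo (-ε) ε :=
    (continuous_const_mul a).tendsto' 0 0 (mul_zero a)
      |>.eventually (Ioo_mem_nhds (neg_lt_zero.2 hε) hε)
  obtain ⟨δ, hδ, hball⟩ := Metric.eventually_nhds_iff_ball.1 hnear
  rw [Real.ball_eq_Ioo, zero_sub, zero_add] at hball
  refine ⟨fun t => c (a * t), ⟨by simpa using h0, δ, hδ,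
    hc.comp (contDiff_const.mul contDiff_id).contDiffOn hball, fun t ht => hcM _ (hball t ht)⟩, ?_⟩
  have hc0 : HasDerivAt c v (a * 0) := by rwa [mul_zero]
  exact hc0.scomp 0 (hasDerivAt_const_mul a)

theorem zero_mem_tangentSpaceAt (hx : x ∈ M) : (0 : E) ∈ tangentSpaceAt M x :=
  ⟨fun _ => x, ⟨rfl, 1, one_pos, contDiffOn_const, fun _ _ => hx⟩, hasDerivAt_const _ _⟩

theorem IsRetraction.fderiv_extension_apply (hR : IsRetraction M R) {S : E × E → E}
    (hx : x ∈ M) (hv : v ∈ tangentSpaceAt M x) (hS : DifferentiableAt ℝ S (x, 0))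
    (hSR : S =ᶠ[𝓝[tangentBundle M] (x, 0)] uncurry R) : fderiv ℝ S (x, 0) (0, v) = v := by
  have hline : HasDerivAt (fun t : ℝ => (x, t • v)) (0, v) 0 := by
    simpa using (hasDerivAt_const (0 : ℝ) x).prodMk ((hasDerivAt_id (0 : ℝ)).smul_const v)
  have hline' : Tendsto (fun t : ℝ => (x, t • v)) (𝓝 0) (𝓝[tangentBundle M] (x, 0)) :=
    tendsto_nhdsWithin_iff.2 ⟨by simpa using hline.continuousAt.tendsto,
      Eventually.of_forall fun t => ⟨hx, smul_mem_tangentSpaceAt hv t⟩⟩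
  have hS' : HasFDerivAt S (fderiv ℝ S (x, 0)) (x, (0 : ℝ) • v) := by
    rw [zero_smul]
    exact hS.hasFDerivAt
  exact (hS'.comp_hasDerivAt 0 hline).unique
    ((hR.deriv_zero x hx v hv).congr_of_eventuallyEq (hline'.eventually hSR))

theorem IsRetraction.exists_contDiffAt_extension (hR : IsRetraction M R) {p : E × E}
    (hp : p ∈ tangentBundle M) :
    ∃ S : E × E → E, ContDiffAt ℝ ∞ S p ∧ S =ᶠ[𝓝[tangentBundle M] p] uncurry R := by
  obtain ⟨U, hU, hpU, S, hS, hSR⟩ := hR.smooth p hp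
  refine ⟨S, hS.contDiffAt (hU.mem_nhds hpU), ?_⟩
  filter_upwards [mem_nhdsWithin_of_mem_nhds (hU.mem_nhds hpU), self_mem_nhdsWithin]
    with q hqU hqM using hSR q ⟨hqU, hqM⟩

theorem IsRetraction.isBigO_sub_sub (hR : IsRetraction M R) (hx : x ∈ M) :
    (fun p : E × E => R p.1 p.2 - p.1 - p.2) =O[𝓝[tangentBundle M] (x, 0)]
      fun p => ‖p.2‖ ^ 2 := by
  obtain ⟨S, hS, hSR⟩ := hR.exists_contDiffAt_extension (p := (x, 0))
    ⟨hx, zero_mem_tangentSpaceAt hx⟩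
  have hbase : Tendsto (fun p : E × E => (p.1, (0 : E))) (𝓝[tangentBundle M] (x, 0))
      (𝓝 (x, 0)) :=
    (by fun_prop : Continuous fun p : E × E => (p.1, (0 : E))).continuousWithinAt
  have htaylor := (isBigO_image_sub_sub_fderiv (hS.of_le (m := 2) (by norm_cast))).comp_tendsto
    (hbase.prodMk_nhds (tendsto_id'.2 nhdsWithin_le_nhds))
  have hdiff : ∀ᶠ p in 𝓝[tangentBundle M] (x, 0), DifferentiableAt ℝ S p :=
    eventually_nhdsWithin_of_eventually_nhds <|
      ((hS.of_le (m := 1) (by norm_cast)).eventually (by simp)).mono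
        fun p hp => hp.differentiableAt one_ne_zero
  have hbaseM : Tendsto (fun p : E × E => (p.1, (0 : E))) (𝓝[tangentBundle M] (x, 0))
      (𝓝[tangentBundle M] (x, 0)) :=
    tendsto_nhdsWithin_iff.2 ⟨hbase, by
      filter_upwards [self_mem_nhdsWithin] with p hp using ⟨hp.1, zero_mem_tangentSpaceAt hp.1⟩⟩
  have hsub : ∀ p : E × E, p - (p.1, 0) = (0, p.2) := fun p => by simp [Prod.ext_iff]
  refine htaylor.congr' ?_ (Eventually.of_forall fun p => by simp [hsub])
  filter_upwards [hSR, hbaseM.eventually hSR, hbaseM.eventually hdiff,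
    hbaseM.eventually (eventually_eventually_nhdsWithin.2 hSR), self_mem_nhdsWithin]
    with p hp hp0 hpdiff hpnear hpM
  have hfderiv := hR.fderiv_extension_apply hpM.1 hpM.2 hpdiff hpnear
  simp only [comp_apply, id, hsub, hfderiv, hp, hp0, uncurry, hR.zero p.1 hpM.1]

theorem IsRetraction.exists_quadratic_bound_near_zero (hR : IsRetraction M R) (hM : IsCompact M) :
    ∃ c : ℝ, 0 ≤ c ∧ ∀ᶠ v in 𝓝 0, ∀ x ∈ M, v ∈ tangentSpaceAt M x →
      ‖R x v - x - v‖ ≤ c * ‖v‖ ^ 2 := by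
  have hloc : ∀ᶠ q in ((atTop : Filter ℝ) ×ˢ 𝓝 (0 : E)) ×ˢ 𝓝ˢ M,
      (q.2, q.1.2) ∈ tangentBundle M → ‖R q.2 q.1.2 - q.2 - q.1.2‖ ≤ q.1.1 * ‖q.1.2‖ ^ 2 := by
    refine hM.mem_prod_nhdsSet_of_forall fun x hx => ?_
    obtain ⟨c, hc⟩ := (hR.isBigO_sub_sub hx).bound
    have hpair : Tendsto (fun q : (ℝ × E) × E => (q.2, q.1.2)) ((atTop ×ˢ 𝓝 0) ×ˢ 𝓝 x)
        (𝓝 (x, 0)) := tendsto_snd.prodMk_nhds (tendsto_snd.comp tendsto_fst)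
    filter_upwards [hpair.eventually (eventually_nhdsWithin_iff.1 hc),
      (tendsto_fst.comp tendsto_fst).eventually (eventually_ge_atTop c)] with q hq hcq hqM
    refine (hq hqM).trans ?_
    rw [norm_pow, norm_norm]
    gcongr
    exact hcq
  obtain ⟨c, hc, hc0⟩ := (hloc.curry.curry.and (eventually_ge_atTop 0)).exists
  exact ⟨c, hc0, hc.mono fun v hv x hx hxv => hv.self_of_nhdsSet x hx ⟨hx, hxv⟩⟩

theorem IsRetraction.exists_quadratic_bound (hR : IsRetraction M R) (hM : IsCompact M) :
    ∃ b : ℝ, 0 ≤ b ∧ ∀ x ∈ M, ∀ v ∈ tangentSpaceAt M x, ‖R x v - x - v‖ ≤ b * ‖v‖ ^ 2 := by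
  obtain ⟨c, hc, hnear⟩ := hR.exists_quadratic_bound_near_zero hM
  obtain ⟨δ, hδ, hball⟩ := Metric.eventually_nhds_iff_ball.1 hnear
  set d := Metric.diam M
  have hd : 0 ≤ d := Metric.diam_nonneg
  refine ⟨max c (d / δ ^ 2 + 1 / δ), hc.trans (le_max_left _ _), fun x hx v hv => ?_⟩
  rcases lt_or_ge ‖v‖ δ with hvδ | hvδ
  · exact (hball v (mem_ball_zero_iff.2 hvδ) x hx hv).trans (by gcongr; exact le_max_left _ _)
  · have hratio : 1 ≤ ‖v‖ / δ := (one_le_div hδ).2 hvδ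
    have hdist : ‖R x v - x‖ ≤ d := by
      rw [← dist_eq_norm]
      exact Metric.dist_le_diam_of_mem hM.isBounded (hR.mapsTo x hx v hv) hx
    calc ‖R x v - x - v‖ ≤ ‖R x v - x‖ + ‖v‖ := norm_sub_le _ _
      _ ≤ d * (‖v‖ / δ) ^ 2 + ‖v‖ * (‖v‖ / δ) := add_le_add
          (hdist.trans (le_mul_of_one_le_right hd (one_le_pow₀ hratio)))
          (le_mul_of_one_le_right (norm_nonneg v) hratio)
      _ = (d / δ ^ 2 + 1 / δ) * ‖v‖ ^ 2 := by field_simp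
      _ ≤ max c (d / δ ^ 2 + 1 / δ) * ‖v‖ ^ 2 := by gcongr; exact le_max_right _ _

theorem IsRetraction.exists_linear_bound (hR : IsRetraction M R) (hM : IsCompact M) :
    ∃ a : ℝ, ∀ x ∈ M, ∀ v ∈ tangentSpaceAt M x, ‖R x v - x‖ ≤ a * ‖v‖ := by
  obtain ⟨b, hb, hquad⟩ := hR.exists_quadratic_bound hM
  set d := Metric.diam M
  have hd : 0 ≤ d := Metric.diam_nonneg
  refine ⟨max (b + 1) d, fun x hx v hv => ?_⟩
  rcases le_total ‖v‖ 1 with hv1 | hv1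
  · calc ‖R x v - x‖ ≤ ‖R x v - x - v‖ + ‖v‖ := by simpa using norm_add_le (R x v - x - v) v
      _ ≤ b * ‖v‖ ^ 2 + ‖v‖ := by gcongr; exact hquad x hx v hv
      _ ≤ b * ‖v‖ + ‖v‖ := by gcongr; exact pow_le_of_le_one (norm_nonneg v) hv1 two_ne_zero
      _ = (b + 1) * ‖v‖ := by ring
      _ ≤ max (b + 1) d * ‖v‖ := by gcongr; exact le_max_left _ _
  · calc ‖R x v - x‖ ≤ d := by
          rw [← dist_eq_norm]
          exact Metric.dist_le_diam_of_mem hM.isBounded (hR.mapsTo x hx v hv) hx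
      _ ≤ max (b + 1) d := le_max_right _ _
      _ ≤ max (b + 1) d * ‖v‖ := le_mul_of_one_le_right (hd.trans (le_max_right _ _)) hv1

end Retraction

section RiemannianGradient

variable {E : Type*} [NormedAddCommGroup E] [InnerProductSpace ℝ E] {M : Set E} {R : E → E → E}
  {h : E → ℝ} {x : E}

theorem HasGradLipRetraction.mono {L L' : ℝ} (hL : HasGradLipRetraction M R h L) (hLL' : L ≤ L') :
    HasGradLipRetraction M R h L' := fun x hx => by
  obtain ⟨g, hg, hle⟩ := hL x hx
  exact ⟨g, hg, fun v hv => (hle v hv).trans (by gcongr)⟩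

/-- The tangent spaces of `M` are linear subspaces admitting an orthogonal projection, so that
differentials on `M` are represented by tangent vectors. -/
def HasTangentProjections (M : Set E) : Prop :=
  ∀ x ∈ M, ∃ T : Submodule ℝ E, T.HasOrthogonalProjection ∧ tangentSpaceAt M x = T

theorem HasTangentProjections.exists_isRiemannianGradient [CompleteSpace E]
    (hM : HasTangentProjections M) (hx : x ∈ M) (hh : DifferentiableAt ℝ h x) :
    ∃ g, IsRiemannianGradient M h x g ∧
      ∀ v ∈ tangentSpaceAt M x, inner ℝ g v = fderiv ℝ h x v := by
  obtain ⟨T, hT, hTx⟩ := hM x hx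
  have hrepr : ∀ v ∈ tangentSpaceAt M x,
      inner ℝ (T.starProjection (∇ h x)) v = fderiv ℝ h x v := fun v hv => by
    rw [hTx, SetLike.mem_coe] at hv
    rw [T.inner_starProjection_left_eq_right, T.starProjection_eq_self_iff.2 hv,
      inner_gradient_left]
  refine ⟨T.starProjection (∇ h x), ⟨hTx ▸ T.starProjection_apply_mem _, fun c v hc hcv => ?_⟩,
    hrepr⟩
  have hh' : HasFDerivAt h (fderiv ℝ h x) (c 0) := hc.1 ▸ hh.hasFDerivAt
  rw [real_inner_comm, hrepr v ⟨c, hc, hcv⟩]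
  exact hh'.comp_hasDerivAt 0 hcv

theorem HasTangentProjections.hasGradLipRetraction [CompleteSpace E]
    (hM : HasTangentProjections M) {s : Set E} {a b : ℝ} {K N : ℝ≥0}
    (hRM : ∀ x ∈ M, ∀ v ∈ tangentSpaceAt M x, R x v ∈ M)
    (hlin : ∀ x ∈ M, ∀ v ∈ tangentSpaceAt M x, ‖R x v - x‖ ≤ a * ‖v‖)
    (hquad : ∀ x ∈ M, ∀ v ∈ tangentSpaceAt M x, ‖R x v - x - v‖ ≤ b * ‖v‖ ^ 2)
    (hs : Convex ℝ s) (hMs : M ⊆ s) (hdiff : ∀ x ∈ s, DifferentiableAt ℝ h x)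
    (hK : LipschitzOnWith K (fderiv ℝ h) s) (hN : ∀ x ∈ M, ‖fderiv ℝ h x‖ ≤ N) :
    HasGradLipRetraction M R h (2 * (N * b + K * a ^ 2)) := fun x hx => by
  obtain ⟨g, hg, hgv⟩ := hM.exists_isRiemannianGradient hx (hdiff x (hMs hx))
  refine ⟨g, hg, fun v hv => ?_⟩
  have hdescent : h (R x v) - h x - fderiv ℝ h x (R x v - x) ≤ K * (a * ‖v‖) ^ 2 :=
    calc h (R x v) - h x - fderiv ℝ h x (R x v - x) ≤ K * ‖R x v - x‖ ^ 2 :=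
          (Real.le_norm_self _).trans
            (norm_image_sub_sub_fderiv_le hs hdiff hK (hMs hx) (hMs (hRM x hx v hv)))
      _ ≤ K * (a * ‖v‖) ^ 2 := by gcongr; exact hlin x hx v hv
  have hfirst : fderiv ℝ h x (R x v - x - v) ≤ N * (b * ‖v‖ ^ 2) :=
    calc fderiv ℝ h x (R x v - x - v) ≤ ‖fderiv ℝ h x‖ * ‖R x v - x - v‖ :=
          (Real.le_norm_self _).trans ((fderiv ℝ h x).le_opNorm _)
      _ ≤ N * (b * ‖v‖ ^ 2) := by gcongr; exacts [hN x hx, hquad x hx v hv]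
  rw [map_sub] at hfirst
  rw [hgv v hv]
  linarith

theorem IsRetraction.exists_hasGradLipRetraction [CompleteSpace E] (hR : IsRetraction M R)
    (hM : IsCompact M) (hT : HasTangentProjections M) {s : Set E} (hs : Convex ℝ s) (hMs : M ⊆ s)
    (K N : ℝ≥0) :
    ∃ L : ℝ, ∀ h : E → ℝ, (∀ x ∈ s, DifferentiableAt ℝ h x) → LipschitzOnWith K (fderiv ℝ h) s →
      (∀ x ∈ M, ‖fderiv ℝ h x‖ ≤ N) → HasGradLipRetraction M R h L := by
  obtain ⟨a, hlin⟩ := hR.exists_linear_bound hM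
  obtain ⟨b, -, hquad⟩ := hR.exists_quadratic_bound hM
  exact ⟨_, fun h hdiff hK hN =>
    hT.hasGradLipRetraction hR.mapsTo hlin hquad hs hMs hdiff hK hN⟩

end RiemannianGradient

section LipschitzConditions

variable {E Y : Type*} [NormedAddCommGroup E] [InnerProductSpace ℝ E] [CompleteSpace E]
  {M : Set E} {R : E → E → E}

theorem IsRetraction.exists_forall_hasGradLipRetraction [NormedAddCommGroup Y] [NormedSpace ℝ Y]
    {C : Set Y} {f : E → Y → ℝ} (hR : IsRetraction M R) (hM : IsCompact M)
    (hT : HasTangentProjections M) (hC : IsBounded C)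
    (hf : IsC11On (uncurry f) (convexHull ℝ M ×ˢ C)) :
    ∃ L : ℝ, ∀ y ∈ C, HasGradLipRetraction M R (fun x => f x y) L := by
  have hMs : M ⊆ convexHull ℝ M := subset_convexHull ℝ M
  obtain ⟨K, hK⟩ := hf.exists_lipschitzOnWith_fderiv_left
  obtain ⟨N, hN⟩ := exists_norm_le_of_lipschitzOnWith hK
    ((isBounded_convexHull.2 hM.isBounded).prod hC)
  obtain ⟨L, hL⟩ := hR.exists_hasGradLipRetraction hM hT (convex_convexHull ℝ M) hMs K N
  refine ⟨L, fun y hy => hL _ (fun x hx => (hasFDerivAt_partial_left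
    (hf.differentiableAt _ (mk_mem_prod hx hy))).differentiableAt)
    (lipschitzOnWith_iff_norm_sub_le.2 fun x₁ hx₁ x₂ hx₂ => ?_)
    fun x hx => hN _ (mk_mem_prod (hMs hx) hy)⟩
  simpa using hK.norm_sub_le (mk_mem_prod hx₁ hy) (mk_mem_prod hx₂ hy)

theorem IsRetraction.lipschitzConditions [NormedAddCommGroup Y] [InnerProductSpace ℝ Y]
    [CompleteSpace Y] {C : Set Y} {f : E → Y → ℝ} (hR : IsRetraction M R)
    (hExp : IsRetraction M (riemannianExp M)) (hM : IsCompact M)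
    (hT : HasTangentProjections M) (hC : IsBounded C)
    (hf : IsC11On (uncurry f) (convexHull ℝ M ×ˢ C)) : LipschitzConditions M C R f where
  differentiable x hx y hy := (hasFDerivAt_partial_right
    (hf.differentiableAt _ (mk_mem_prod (subset_convexHull ℝ M hx) hy))).differentiableAt
  grad_y := by
    obtain ⟨L, hL0, hL⟩ := hf.exists_norm_gradient_right_sub_le
    refine ⟨L, hL0, fun x hx y₁ hy₁ y₂ hy₂ => ?_⟩
    have hx' := subset_convexHull ℝ M hx
    simpa using hL x hx' x hx' y₁ hy₁ y₂ hy₂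
  grad_x := by
    obtain ⟨L₁, hL₁⟩ := hExp.exists_forall_hasGradLipRetraction hM hT hC hf
    obtain ⟨L₂, hL₂⟩ := hR.exists_forall_hasGradLipRetraction hM hT hC hf
    refine ⟨max 1 (max L₁ L₂), le_max_left _ _, fun y hy => ⟨(hL₁ y hy).mono ?_,
      (hL₂ y hy).mono ?_⟩⟩
    exacts [(le_max_left _ _).trans (le_max_right _ _), (le_max_right _ _).trans (le_max_right _ _)]
  grad_xy := by
    obtain ⟨L, hL0, hL⟩ := hf.exists_norm_gradient_right_sub_le
    refine ⟨L, hL0, fun x₁ hx₁ x₂ hx₂ y hy => ?_⟩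
    simpa using hL x₁ (subset_convexHull ℝ M hx₁) x₂ (subset_convexHull ℝ M hx₂) y hy y hy

end LipschitzConditions

section OrthogonalGroup

attribute [local instance] Matrix.frobeniusNormedRing Matrix.frobeniusNormedAlgebra

open Matrix

variable {n : ℕ} {Q : Matrix (Fin n) (Fin n) ℝ}

theorem norm_sq_eq_trace (A : Matrix (Fin n) (Fin n) ℝ) : ‖A‖ ^ 2 = (Aᵀ * A).trace := by
  rw [← real_inner_self_eq_norm_sq, inner_eq_trace]

theorem norm_of_mem_orthogonalMatrices (hQ : Q ∈ orthogonalMatrices n) : ‖Q‖ = √n := by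
  rw [eq_comm, Real.sqrt_eq_iff_eq_sq n.cast_nonneg (norm_nonneg Q), norm_sq_eq_trace,
    mem_orthogonalMatrices.1 hQ, Matrix.trace_one, Fintype.card_fin]

theorem norm_conj_of_mem_orthogonalMatrices (hQ : Q ∈ orthogonalMatrices n)
    (A : Matrix (Fin n) (Fin n) ℝ) : ‖Q * A * Qᵀ‖ = ‖A‖ := by
  rw [← sq_eq_sq₀ (norm_nonneg _) (norm_nonneg _), norm_sq_eq_trace, norm_sq_eq_trace]
  calc ((Q * A * Qᵀ)ᵀ * (Q * A * Qᵀ)).trace = (Q * (Aᵀ * (Qᵀ * Q) * A * Qᵀ)).trace := by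
        simp only [transpose_mul, transpose_transpose, Matrix.mul_assoc]
    _ = (Aᵀ * A * (Qᵀ * Q)).trace := by
        rw [mem_orthogonalMatrices.1 hQ, Matrix.trace_mul_comm, Matrix.mul_one, Matrix.mul_assoc,
          mem_orthogonalMatrices.1 hQ]
    _ = (Aᵀ * A).trace := by rw [mem_orthogonalMatrices.1 hQ, Matrix.mul_one]

theorem isCompact_orthogonalMatrices : IsCompact (orthogonalMatrices n) := by
  have heq : orthogonalMatrices n = {Q | Qᵀ * Q = 1} := Set.ext fun _ => mem_orthogonalMatrices
  refine Metric.isCompact_of_isClosed_isBounded ?_ (Metric.isBounded_closedBall.subset fun Q hQ =>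
    mem_closedBall_zero_iff.2 (norm_of_mem_orthogonalMatrices hQ).le)
  rw [heq]
  exact isClosed_eq (by fun_prop) continuous_const

/-- The matrices `V` with `Qᵀ V` skew-symmetric: the tangent space of `O(n)` at `Q ∈ O(n)`. -/
def orthogonalTangent (Q : Matrix (Fin n) (Fin n) ℝ) :
    Submodule ℝ (Matrix (Fin n) (Fin n) ℝ) where
  carrier := {V | (Qᵀ * V)ᵀ = -(Qᵀ * V)}
  add_mem' := fun {V W} (hV : _ = _) (hW : _ = _) => by
    rw [Set.mem_ofPred_eq, Matrix.mul_add, transpose_add, hV, hW, neg_add]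
  zero_mem' := by simp
  smul_mem' := fun a V (hV : _ = _) => by
    rw [Set.mem_ofPred_eq, Matrix.mul_smul, transpose_smul, hV, smul_neg]

theorem tangentSpaceAt_orthogonalMatrices (hQ : Q ∈ orthogonalMatrices n) :
    tangentSpaceAt (orthogonalMatrices n) Q = orthogonalTangent Q := by
  refine Subset.antisymm (fun V hV => transpose_mul_skew hV) fun V hV => ?_
  have hQV : Q * (Qᵀ * V) = V := by
    rw [← Matrix.mul_assoc, mul_transpose_of_mem hQ, Matrix.one_mul]
  exact hQV ▸ mul_skew_mem_tangent hQ hV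

theorem hasTangentProjections_orthogonalMatrices :
    HasTangentProjections (orthogonalMatrices n) := fun Q hQ =>
  ⟨orthogonalTangent Q, inferInstance, tangentSpaceAt_orthogonalMatrices hQ⟩

theorem riemannianExp_eq {v : Matrix (Fin n) (Fin n) ℝ} (hQ : Q ∈ orthogonalMatrices n)
    (hv : v ∈ tangentSpaceAt (orthogonalMatrices n) Q) :
    riemannianExp (orthogonalMatrices n) Q v = Q * NormedSpace.exp (Qᵀ * v) := by
  have hgeo := exists_geodesic hQ hv
  rw [riemannianExp, dif_pos hgeo, geodesic_eq hgeo.choose_spec 1, one_smul]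

theorem contDiff_transpose {k : WithTop ℕ∞} :
    ContDiff ℝ k (transpose : Matrix (Fin n) (Fin n) ℝ → Matrix (Fin n) (Fin n) ℝ) :=
  (LinearMap.toContinuousLinearMap (transposeLinearEquiv (Fin n) (Fin n) ℝ ℝ).toLinearMap).contDiff

theorem isRetraction_riemannianExp :
    IsRetraction (orthogonalMatrices n) (riemannianExp (orthogonalMatrices n)) where
  mapsTo Q hQ v hv := by
    rw [riemannianExp_eq hQ hv]
    simpa using mul_mem_orthogonal hQ (exp_skew_mem (transpose_mul_skew hv) 1)
  smooth p _ := by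
    refine ⟨univ, isOpen_univ, mem_univ _, fun q => q.1 * NormedSpace.exp (q.1ᵀ * q.2), ?_,
      fun q hq => (riemannianExp_eq hq.2.1 hq.2.2).symm⟩
    have hexp : ContDiff ℝ ∞ (NormedSpace.exp : Matrix (Fin n) (Fin n) ℝ → _) :=
      contDiff_iff_contDiffAt.2 fun x => (NormedSpace.exp_analytic (𝕂 := ℝ) x).contDiffAt
    exact (contDiff_fst.mul (hexp.comp
      ((contDiff_transpose.comp contDiff_fst).mul contDiff_snd))).contDiffOn
  zero Q hQ := by
    rw [riemannianExp_eq hQ (zero_mem_tangentSpaceAt hQ)]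
    simp
  deriv_zero Q hQ v hv := by
    have hderiv := hasDerivAt_mul_exp Q (Qᵀ * v) 0
    rw [zero_smul, NormedSpace.exp_zero, mul_one, ← mul_assoc, mul_transpose_of_mem hQ,
      one_mul] at hderiv
    refine hderiv.congr_of_eventuallyEq (Eventually.of_forall fun t => ?_)
    simp only [riemannianExp_eq hQ (smul_mem_tangentSpaceAt hv t), Matrix.mul_smul]

end OrthogonalGroup

section Submodule

variable {E F : Type*} [NormedAddCommGroup E] [NormedSpace ℝ E] [NormedAddCommGroup F]
  [InnerProductSpace ℝ F] {S : Submodule ℝ F} [S.HasOrthogonalProjection] {k : WithTop ℕ∞}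

theorem contDiff_of_contDiff_coe {g : E → S} (hg : ContDiff ℝ k fun x => (g x : F)) :
    ContDiff ℝ k g := by
  simpa only [comp_def, Submodule.orthogonalProjectionOnto_mem_subspace_eq_self] using
    S.orthogonalProjectionOnto.contDiff.comp hg

end Submodule

section SpectralObjective

attribute [local instance] Matrix.frobeniusNormedRing Matrix.frobeniusNormedAlgebra

open Matrix

variable {n : ℕ} {F : symMatrix n → ℝ}

theorem contDiff_conjDiag {k : WithTop ℕ∞} : ContDiff ℝ k (uncurry (conjDiag (n := n))) := by
  have hdiag : ContDiff ℝ k fun l : EuclideanSpace ℝ (Fin n) =>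
      (diagonal fun i => l i : Matrix (Fin n) (Fin n) ℝ) :=
    (LinearMap.toContinuousLinearMap ((diagonalLinearMap (Fin n) ℝ ℝ).comp
      (WithLp.linearEquiv 2 ℝ (Fin n → ℝ)).toLinearMap)).contDiff
  refine contDiff_of_contDiff_coe ?_
  exact (contDiff_fst.mul (hdiag.comp contDiff_snd)).mul (contDiff_transpose.comp contDiff_fst)

theorem differentiable_uncurry_spectralObjective (hF : Differentiable ℝ F) :
    Differentiable ℝ (uncurry (spectralObjective F)) :=
  hF.comp (contDiff_conjDiag.differentiable one_ne_zero)

theorem isC11On_spectralObjective (hF : IsC11On F univ) {s : Set (Matrix (Fin n) (Fin n) ℝ)}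
    {C : Set (EuclideanSpace ℝ (Fin n))} (hs : IsBounded s) (hC : IsBounded C) :
    IsC11On (uncurry (spectralObjective F)) (s ×ˢ C) := by
  obtain ⟨r, hr⟩ := (hs.prod hC).subset_closedBall 0
  have hball := convex_closedBall
    (0 : Matrix (Fin n) (Fin n) ℝ × EuclideanSpace ℝ (Fin n)) r
  exact (hF.comp (IsC11On.of_contDiff contDiff_conjDiag hball (isCompact_closedBall 0 r))
    (mapsTo_univ _ _) hball Metric.isBounded_closedBall).mono hr

/-- The linear map `l ↦ Q Diag(l) Qᵀ`, which is isometric for orthogonal `Q`. -/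
def conjDiagIsometry (Q : Matrix (Fin n) (Fin n) ℝ) (hQ : Q ∈ orthogonalMatrices n) :
    EuclideanSpace ℝ (Fin n) →ₗᵢ[ℝ] symMatrix n where
  toFun := conjDiag Q
  map_add' l m := Subtype.ext <| by
    simp [conjDiag, ← Matrix.diagonal_add, Matrix.mul_add, Matrix.add_mul]
  map_smul' a l := Subtype.ext <| by
    change Q * diagonal (a • fun i => l i) * Qᵀ = a • (Q * diagonal (fun i => l i) * Qᵀ)
    rw [diagonal_smul, Matrix.mul_smul, Matrix.smul_mul]
  norm_map' l := (norm_conj_of_mem_orthogonalMatrices hQ _).trans (frobenius_norm_diagonal _)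

theorem norm_le_sqrt_mul_norm (x : EuclideanSpace ℝ (Fin n)) : ‖x‖ ≤ √n * ‖x‖ := by
  rcases n.eq_zero_or_pos with rfl | hn
  · simp [Subsingleton.elim x 0]
  · exact le_mul_of_one_le_left (norm_nonneg x) (Real.one_le_sqrt.2 (Nat.one_le_cast.2 hn))

theorem norm_gradient_spectralObjective_sub_le {Q : Matrix (Fin n) (Fin n) ℝ} {L : ℝ}
    (hF : Differentiable ℝ F) (hL : ∀ X₁ X₂, ‖∇ F X₁ - ∇ F X₂‖ ≤ L * ‖X₁ - X₂‖)
    (hQ : Q ∈ orthogonalMatrices n) (l₁ l₂ : EuclideanSpace ℝ (Fin n)) :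
    ‖∇ (spectralObjective F Q) l₁ - ∇ (spectralObjective F Q) l₂‖ ≤ L * ‖l₁ - l₂‖ := by
  set T := conjDiagIsometry Q hQ
  calc ‖∇ (F ∘ T) l₁ - ∇ (F ∘ T) l₂‖ ≤ ‖∇ F (T l₁) - ∇ F (T l₂)‖ :=
        norm_gradient_comp_linearIsometry_sub_le hF T l₁ l₂
    _ ≤ L * ‖l₁ - l₂‖ := by
        rw [← T.norm_map (l₁ - l₂), map_sub]
        exact hL _ _

end SpectralObjective

end SpectralLip

theorem mainTheorem4 (n : ℕ) (F : SpectralLip.symMatrix n → ℝ) (L_F : ℝ) (hL_F : 0 < L_F)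
    (hF : Differentiable ℝ F)
    (hF_lip : ∀ X₁ X₂ : SpectralLip.symMatrix n, ‖∇ F X₁ - ∇ F X₂‖ ≤ L_F * ‖X₁ - X₂‖)
    (C : Set (EuclideanSpace ℝ (Fin n))) (D : ℝ) (hC : ∀ l ∈ C, ‖l‖ ≤ D) :
    (∀ R : Matrix (Fin n) (Fin n) ℝ → Matrix (Fin n) (Fin n) ℝ → Matrix (Fin n) (Fin n) ℝ,
      SpectralLip.IsRetraction (SpectralLip.orthogonalMatrices n) R →
      SpectralLip.LipschitzConditions (SpectralLip.orthogonalMatrices n) C R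
        (SpectralLip.spectralObjective F)) ∧
    (∀ Q ∈ SpectralLip.orthogonalMatrices n,
      Differentiable ℝ (SpectralLip.spectralObjective F Q) ∧
      ∀ l₁ l₂ : EuclideanSpace ℝ (Fin n),
        ‖∇ (SpectralLip.spectralObjective F Q) l₁ - ∇ (SpectralLip.spectralObjective F Q) l₂‖
          ≤ Real.sqrt n * L_F * ‖l₁ - l₂‖) ∧
    (∃ L_G : ℝ, 0 ≤ L_G ∧ ∀ l ∈ C,
      Differentiable ℝ (fun U => SpectralLip.spectralObjective F U l) ∧
      ∀ U ∈ convexHull ℝ (SpectralLip.orthogonalMatrices n),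
      ∀ V ∈ convexHull ℝ (SpectralLip.orthogonalMatrices n),
        ‖∇ (fun W => SpectralLip.spectralObjective F W l) U
            - ∇ (fun W => SpectralLip.spectralObjective F W l) V‖ ≤ L_G * ‖U - V‖) := by
  have hC_bdd : Bornology.IsBounded C :=
    Metric.isBounded_closedBall.subset fun l hl => mem_closedBall_zero_iff.2 (hC l hl)
  have hconv : Bornology.IsBounded (convexHull ℝ (SpectralLip.orthogonalMatrices n)) :=
    isBounded_convexHull.2 SpectralLip.isCompact_orthogonalMatrices.isBounded
  have hF_C11 : SpectralLip.IsC11On F univ :=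
    SpectralLip.IsC11On.of_norm_gradient_sub_le (fun X _ => hF X) fun X _ Y _ => hF_lip X Y
  have hf := SpectralLip.isC11On_spectralObjective hF_C11 hconv hC_bdd
  have hf_diff := SpectralLip.differentiable_uncurry_spectralObjective hF
  refine ⟨fun R hR => ?_, fun Q hQ => ⟨fun l => ?_, fun l₁ l₂ => ?_⟩, ?_⟩
  · exact hR.lipschitzConditions SpectralLip.isRetraction_riemannianExp
      SpectralLip.isCompact_orthogonalMatrices SpectralLip.hasTangentProjections_orthogonalMatrices
      hC_bdd hf
  · exact (SpectralLip.hasFDerivAt_partial_right (hf_diff (Q, l))).differentiableAt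
  · refine (SpectralLip.norm_gradient_spectralObjective_sub_le hF hF_lip hQ l₁ l₂).trans ?_
    rw [mul_comm √(n : ℝ), mul_assoc]
    exact mul_le_mul_of_nonneg_left (SpectralLip.norm_le_sqrt_mul_norm _) hL_F.le
  · obtain ⟨L, hL0, hL⟩ := hf.exists_norm_gradient_left_sub_le
    exact ⟨L, hL0, fun l hl => ⟨fun U =>
      (SpectralLip.hasFDerivAt_partial_left (hf_diff (U, l))).differentiableAt, hL l hl⟩⟩
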